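/- Let $M$ be a finite monoid that is almost R-trivial: for every $b\in M$ for which there is $b'\neq b$ with $b'M=bM$, one has $ab=b$ for all $a\in M$. Let $\mathbb X(M)=\{aM : a\in M\}$, ordered by inclusion, with $M$ acting by $b(aM)=(ba)M$. Let $\mathbb Y(M)$ be the set of all non-empty linearly ordered subsets of $\mathbb X(M)$, ordered by end-extension ($x\le y$ iff $x\subseteq y$ and $i<j$ for all $i\in x$, $j\in y\setminus x$), with $M$ acting by $a(x)=\{a(i) : i\in x\}$. Let $\langle\mathbb Y(M)\rangle$ be the semigroup, with operation $\vee$, generated freely by the elements of $\mathbb Y(M)$ subject to the relations $p\vee q=q\vee p=q$ whenever $p\le q$ in $\mathbb Y(M)$. A pointed $M$-set is a set $X$ with an action of $M$ and a distinguished point $x\in X$ such that $Mx=X$. Let $(X_n)_{n\in\mathbb N}$ be a sequence of pointed $M$-sets; the $X_n$ may be disjoint or may overlap, the actions of $M$ agreeing on common elements. Let $\langle (X_n)\rangle$ be the set of all finite sequences (words) $x_1\cdots x_k$ for which there are $m_1<\cdots<m_k$ with $x_i\in X_{m_i}$ for all $i$. The product of $x_1\cdots x_k$ and $y_1\cdots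 y_l$ is defined if there are $m_1<\cdots<m_k<n_1<\cdots<n_l$ with $x_i\in X_{m_i}$ and $y_j\in X_{n_j}$ for all $i,j$, and it is then the concatenation of the two words. Let $M$ act on $\langle (X_n)\rangle$ by $a(x_1\cdots x_k)=a(x_1)\cdots a(x_k)$. A sequence $(w_i)_{i\in\mathbb N}$ in $\langle (X_n)\rangle$ is basic if the product $w_{i_0}\cdots w_{i_k}$ is defined for all $i_0<\cdots<i_k$. Let $F$ be a finite subset of $\langle\mathbb Y(M)\rangle$ and let $\mathbf y$ be a maximal element of $\mathbb Y(M)$. Then for every coloring of $\langle (X_n)\rangle$ with finitely many colors there is a basic sequence $(w_i)$ in $\langle (X_n)\rangle$ such that (i) for each $i$, the word $w_i$ contains the distinguished point of some $X_n$; and (ii) for all $k\ge 0$, $i_0<\cdots<i_k$ and $a_0,\dots,a_k\in M$ with $a_0(\mathbf y)\vee\cdots\vee a_k(\mathbf y)\in F$, the product $a_0(w_{i_0})\cdots a_k(w_{i_k})$ is defined and its color depends only on the element $a_0(\mathbf y)\vee\cdots\vee a_k(\mathbf y)$ of $\langle\mathbb Y(M)\rangle$. -/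

import Mathlib

namespace MonoidRamsey

/-! ### Almost R-trivial monoids and the partial order of principal right ideals -/

section Monoid

variable (M : Type*) [Monoid M]

variable {M} in
/-- The principal right ideal `a M`. -/
def rightIdeal (a : M) : Set M := {c | ∃ d : M, c = a * d}

/-- If the R-class of `b` (all `b'` with `b' M = b M`) has more than one element, then `a b = b`
for all `a`. -/
def AlmostRTrivial : Prop :=
  ∀ b b' : M, b' ≠ b → rightIdeal b' = rightIdeal b → ∀ a : M, a * b = b

/-- `𝕏(M) = {a M : a ∈ M}`, ordered by inclusion (the order inherited from `Set M`). -/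
def XX : Type _ := {I : Set M // ∃ a : M, I = rightIdeal a}

instance : PartialOrder (XX M) :=
  inferInstanceAs (PartialOrder {I : Set M // ∃ a : M, I = rightIdeal a})

/-- The action of `M` on `𝕏(M)` by left translation of sets, `b (a M) = (b a) M`. -/
instance : SMul M (XX M) where
  smul b I := ⟨(fun c => b * c) '' I.1, by
    obtain ⟨a, ha⟩ := I.2
    refine ⟨b * a, ?_⟩
    ext c
    simp only [ha, rightIdeal, Set.mem_image, Set.mem_ofPred_eq]
    constructor
    · rintro ⟨_, ⟨d, rfl⟩, rfl⟩
      exact ⟨d, (mul_assoc b a d).symm⟩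
    · rintro ⟨d, rfl⟩
      exact ⟨a * d, ⟨d, rfl⟩, (mul_assoc b a d).symm⟩⟩

instance : CovariantClass M (XX M) HSMul.hSMul LE.le where
  elim b _ _ h := Set.image_mono (f := fun c => b * c) h

end Monoid

/-! ### The forest of nonempty chains -/

section Forest

/-- `Fr(P)`: the nonempty linearly ordered subsets of `P`. -/
def Fr (P : Type*) [PartialOrder P] : Type _ := {x : Set P // x.Nonempty ∧ IsChain (· ≤ ·) x}

variable {P : Type*} [PartialOrder P]

/-- The end-extension order. -/
instance : PartialOrder (Fr P) where
  le x y := x.1 ⊆ y.1 ∧ ∀ i ∈ x.1, ∀ j ∈ y.1 \ x.1, i < j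
  le_refl x := ⟨subset_rfl, fun _ _ _ hj => absurd hj.1 hj.2⟩
  le_trans x y z hxy hyz := ⟨hxy.1.trans hyz.1, fun i hi j hj => by
    by_cases hjy : j ∈ y.1
    · exact hxy.2 i hi j ⟨hjy, hj.2⟩
    · exact hyz.2 i (hxy.1 hi) j ⟨hj.1, hjy⟩⟩
  le_antisymm x y hxy hyx := Subtype.ext (hxy.1.antisymm hyx.1)

/-- The induced action `a x = {a i : i ∈ x}`. -/
instance {M : Type*} [SMul M P] [CovariantClass M P HSMul.hSMul LE.le] : SMul M (Fr P) where
  smul a x := ⟨(fun i => a • i) '' x.1, x.2.1.image _, by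
    rintro _ ⟨i, hi, rfl⟩ _ ⟨j, hj, rfl⟩ _
    exact (x.2.2.total hi hj).imp
      (CovariantClass.elim a) (CovariantClass.elim a)⟩

/-- `𝕐(M) = Fr(𝕏(M))`. -/
abbrev YY (M : Type*) [Monoid M] : Type _ := Fr (XX M)

end Forest

/-! ### The semigroup generated by a partial order -/

section Vee

/-- The defining relations `p ∨ q = q ∨ p = q` for `p ≤ q`, with `∨` written as multiplication
of the free semigroup. -/
inductive VeeRel (P : Type*) [PartialOrder P] : FreeSemigroup P → FreeSemigroup P → Prop
  | left {p q : P} (h : p ≤ q) :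
      VeeRel P (FreeSemigroup.of p * FreeSemigroup.of q) (FreeSemigroup.of q)
  | right {p q : P} (h : p ≤ q) :
      VeeRel P (FreeSemigroup.of q * FreeSemigroup.of p) (FreeSemigroup.of q)

/-- The semigroup `⟨P⟩`: the free semigroup on `P` modulo the congruence generated by the
relations above. Its operation `∨` is written as multiplication. -/
abbrev Vee (P : Type*) [PartialOrder P] : Type _ := (conGen (VeeRel P)).Quotient

/-- The image of `p ∈ P` in `⟨P⟩`. -/
def Vee.of {P : Type*} [PartialOrder P] (p : P) : Vee P :=
  ((FreeSemigroup.of p : FreeSemigroup P) : (conGen (VeeRel P)).Quotient)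

/-- `p 0 ∨ p 1 ∨ ⋯ ∨ p k` in `⟨P⟩`. -/
def Vee.join {P : Type*} [PartialOrder P] : {k : ℕ} → (Fin (k + 1) → P) → Vee P
  | 0, p => Vee.of (p 0)
  | _ + 1, p => Vee.of (p 0) * Vee.join fun j => p j.succ

end Vee

/-! ### Words over a sequence of pointed `M`-sets -/

section Words

/-- A pointed `M`-set: a set `carrier` with an action of `M` and a distinguished point `pt` with
`M pt = carrier`. It lives in an ambient `M`-set `Ω`, so that the members of a sequence of pointed
`M`-sets may overlap (with the same action on common elements) or be disjoint
(for example inside a disjoint union). -/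
structure PointedMSet (M Ω : Type*) [Monoid M] [MulAction M Ω] where
  carrier : Set Ω
  pt : Ω
  orbit_pt : {y : Ω | ∃ a : M, y = a • pt} = carrier

variable {M Ω : Type*} [Monoid M] [MulAction M Ω]

theorem PointedMSet.smul_mem (X : PointedMSet M Ω) (a : M) {y : Ω} (hy : y ∈ X.carrier) :
    a • y ∈ X.carrier := by
  rw [← X.orbit_pt] at hy ⊢
  obtain ⟨b, rfl⟩ := hy
  exact ⟨a * b, smul_smul a b _⟩

/-- `u = x₁ ⋯ xₖ`, `m = m₁ ⋯ mₖ` and `xᵢ ∈ X_{mᵢ}` for all `i`. -/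
def LocatedAt (X : ℕ → PointedMSet M Ω) (u : List Ω) (m : List ℕ) : Prop :=
  List.Forall₂ (fun y n => y ∈ (X n).carrier) u m

/-- `⟨(X_n)⟩`: finite sequences `x₁ ⋯ xₖ` for which there are `m₁ < ⋯ < mₖ` with
`xᵢ ∈ X_{mᵢ}`. -/
def Word (X : ℕ → PointedMSet M Ω) : Type _ :=
  {u : List Ω // ∃ m : List ℕ, m.Pairwise (· < ·) ∧ LocatedAt X u m}

variable {X : ℕ → PointedMSet M Ω}

/-- The partial product on `⟨(X_n)⟩`: the product of `x₁ ⋯ xₖ` and `y₁ ⋯ yₗ` is defined if there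
are `m₁ < ⋯ < mₖ < n₁ < ⋯ < nₗ` with `xᵢ ∈ X_{mᵢ}` and `yᵢ ∈ X_{nᵢ}`; it is the concatenation. -/
def Word.mul (u v : Word X) : Part (Word X) where
  Dom := ∃ m n : List ℕ, (m ++ n).Pairwise (· < ·) ∧ LocatedAt X u.1 m ∧ LocatedAt X v.1 n
  get h := ⟨u.1 ++ v.1, by
    obtain ⟨m, n, hmn, hu, hv⟩ := h
    exact ⟨m ++ n, hmn, List.rel_append hu hv⟩⟩

/-- The product `u 0 ⋅ u 1 ⋯ u k` in the partial semigroup `⟨(X_n)⟩`. -/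
def Word.prod : {k : ℕ} → (Fin (k + 1) → Word X) → Part (Word X)
  | 0, u => Part.some (u 0)
  | _ + 1, u => (Word.prod fun j => u j.succ).bind fun v => Word.mul (u 0) v

/-- The action `a (x₁ ⋯ xₖ) = a(x₁) ⋯ a(xₖ)`. -/
instance : SMul M (Word X) where
  smul a u := ⟨u.1.map fun y => a • y, by
    obtain ⟨m, hm, hu⟩ := u.2
    refine ⟨m, hm, ?_⟩
    unfold LocatedAt at hu ⊢
    rw [List.forall₂_map_left_iff]
    exact hu.imp fun y n hy => (X n).smul_mem a hy⟩

/-- All products `w_{i₀} ⋯ w_{iₖ}` with `i₀ < ⋯ < iₖ` are defined. -/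
def IsBasic (w : ℕ → Word X) : Prop :=
  ∀ (k : ℕ) (i : Fin (k + 1) → ℕ), StrictMono i → (Word.prod fun j => w (i j)).Dom

end Words

end MonoidRamsey

/-! A letter of `X n` is some `b` times the distinguished point, so colorings may be pulled back to
located words, i.e. words in `ℕ × M`. The ultrafilters on these that concentrate on increasing words
with arbitrarily late locations form a compact semigroup with continuous right multiplications, on
which `M` acts by continuous endomorphisms. Those concentrating on words with a distinguished point
form a closed two-sided ideal.

The core is `exists_equivariant_ultrafilters`: an equivariant `g` on `YY M` with `g D * g C = g C *
g D = g C` for `D ≤ C`, and with `g y` in the ideal for maximal `y`. Almost R-triviality enters only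
in `exists_mem_smul_eq_smul`, which finds a point of the ideal on which R-equivalent elements act
alike. Sending a chain with maximum `k M` to `k` times that point is then well defined and
equivariant. `exists_orderReversing` improves this map by repeatedly taking idempotents in
semigroups of equivariant maps.

The relations satisfied by `g` are those defining `Vee (YY M)`, so the product of the `g (a j • y)`
depends only on the join of the `a j • y`. The color of a join is the color that this product
ultrafilter selects. A Galvin–Glazer recursion (`Stage.exists_next`) picks words realizing these
colors. Each step can meet only finitely many demands; the finiteness of `F` provides this through a
bound on the lengths of normal forms. -/

namespace MonoidRamsey

/-! ### Normal forms in the semigroup of a forest -/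

section NormalForm

variable {P : Type*} [PartialOrder P]

open Classical in
/-- Prefix a letter to a word, absorbing it or the head of the word if they are comparable. -/
noncomputable def absorbCons (p : P) : List P → List P
  | [] => [p]
  | q :: t => if p ≤ q then q :: t else if q ≤ p then p :: t else p :: q :: t

theorem length_le_length_absorbCons (p : P) (l : List P) :
    l.length ≤ (absorbCons p l).length := by
  cases l with
  | nil => simp
  | cons q t => simp only [absorbCons]; split_ifs <;> simp

theorem absorbCons_absorbCons_of_le {p q : P} (h : p ≤ q) (l : List P) :
    absorbCons p (absorbCons q l) = absorbCons q l := by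
  cases l with
  | nil => simp [absorbCons, h]
  | cons r t =>
    by_cases h1 : q ≤ r
    · simp [absorbCons, h1, h.trans h1]
    · by_cases h2 : r ≤ q <;> simp [absorbCons, h1, h2, h]

/-- The forest property is needed when `p` and the head `r` are incomparable: `r ≤ q` would put both
below `q` and make them comparable, so `q` absorbs `p` and nothing more. -/
theorem absorbCons_absorbCons_of_ge
    (forest : ∀ x y z : P, x ≤ z → y ≤ z → x ≤ y ∨ y ≤ x)
    {p q : P} (h : p ≤ q) (l : List P) :
    absorbCons q (absorbCons p l) = absorbCons q l := by
  have key : ∀ t : List P, absorbCons q (p :: t) = q :: t := by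
    intro t
    by_cases h1 : q ≤ p
    · simp [absorbCons, le_antisymm h h1]
    · simp [absorbCons, h1, h]
  cases l with
  | nil => exact key []
  | cons r t =>
    by_cases h1 : p ≤ r
    · simp [absorbCons, h1]
    · by_cases h2 : r ≤ p
      · have h3 : absorbCons p (r :: t) = p :: t := by simp [absorbCons, h1, h2]
        have h4 : ¬ q ≤ r := fun h' => h1 (h.trans h')
        rw [h3, key]
        simp [absorbCons, h4, h2.trans h]
      · have h3 : absorbCons p (r :: t) = p :: r :: t := by simp [absorbCons, h1, h2]
        have h4 : ¬ q ≤ r := fun h' => h1 (h.trans h')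
        have h5 : ¬ r ≤ q := fun h' => (forest p r q h h').elim h1 h2
        rw [h3, key]
        simp [absorbCons, h4, h5]

/-- In the semigroup of a forest, left multiplication by generators is realised by `absorbCons`. -/
theorem exists_normalForm (forest : ∀ x y z : P, x ≤ z → y ≤ z → x ≤ y ∨ y ≤ x) :
    ∃ nf : Vee P → List P, (∀ p, nf (Vee.of p) = [p]) ∧
      ∀ p f, nf (Vee.of p * f) = absorbCons p (nf f) := by
  let Φ : FreeSemigroup P →ₙ* Function.End (List P) :=
    FreeSemigroup.lift (fun p => (absorbCons p : Function.End (List P)))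
  -- The defining relations hold between the self-maps `absorbCons p` of all lists, so the action
  -- descends to `Vee P`; the normal form is the image of the empty list.
  have hle : conGen (VeeRel P) ≤ Con.ker Φ := by
    rw [Con.conGen_le]
    rintro x y (⟨h⟩ | ⟨h⟩)
    · rw [Con.ker_rel, map_mul]
      simp only [Φ]
      funext l
      exact absorbCons_absorbCons_of_le h l
    · rw [Con.ker_rel, map_mul]
      simp only [Φ]
      funext l
      exact absorbCons_absorbCons_of_ge forest h l
  refine ⟨fun f => Con.liftOn f (fun w => Φ w []) fun a b hab => ?_, fun p => ?_, fun p f => ?_⟩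
  · have : Φ a = Φ b := hle hab
    simp only [this]
  · change Φ (FreeSemigroup.of p) [] = [p]
    simp only [Φ]
    rfl
  · induction f using Con.induction_on with
    | _ w =>
      change Φ (FreeSemigroup.of p * w) [] = absorbCons p (Φ w [])
      rw [map_mul]
      simp only [Φ]
      rfl

theorem foldr_absorbCons_eq_normalForm_join {nf : Vee P → List P}
    (h1 : ∀ p, nf (Vee.of p) = [p])
    (h2 : ∀ p f, nf (Vee.of p * f) = absorbCons p (nf f)) :
    ∀ {k : ℕ} (p : Fin (k + 1) → P),
      (List.ofFn p).foldr absorbCons [] = nf (Vee.join p)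
  | 0, p => by simp [Vee.join, h1, absorbCons]
  | k + 1, p => by
    rw [List.ofFn_succ, List.foldr_cons,
      foldr_absorbCons_eq_normalForm_join h1 h2 (fun j => p j.succ), Vee.join, h2]

/-- Absorption never shortens a list. A length bound on the result therefore leaves only finitely
many possible tails `h`. -/
theorem length_le_length_foldr_absorbCons (l h : List P) :
    h.length ≤ (l.foldr absorbCons h).length := by
  induction l with
  | nil => exact le_rfl
  | cons p l ih => exact ih.trans (length_le_length_absorbCons p _)

end NormalForm

/-! ### Building chains from below -/

namespace Fr

section

variable {P : Type*} [PartialOrder P]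

/-- Initial segments of one chain are nested: an element of `x` outside `y` lies above all of `y`.
-/
theorem comparable_of_le_of_le (x y z : Fr P) (hx : x ≤ z) (hy : y ≤ z) : x ≤ y ∨ y ≤ x := by
  by_cases h : x.1 ⊆ y.1
  · exact Or.inl ⟨h, fun i hi j hj => hx.2 i hi j ⟨hy.1 hj.1, hj.2⟩⟩
  · obtain ⟨i, hix, hiy⟩ := Set.not_subset.mp h
    have hlt : ∀ k ∈ y.1, k < i := fun k hk => hy.2 k hk i ⟨hx.1 hix, hiy⟩
    refine Or.inr ⟨fun k hk => ?_, fun k hk j hj => hy.2 k hk j ⟨hx.1 hj.1, hj.2⟩⟩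
    by_contra hkx
    exact (hlt k hk).asymm (hx.2 i hix k ⟨hy.1 hk, hkx⟩)

/-- The one-element chain. -/
def single (K : P) : Fr P := ⟨{K}, Set.singleton_nonempty K, Set.pairwise_singleton _ _⟩

/-- Extend a chain by a new largest element. -/
def snoc (D : Fr P) (K : P) (h : ∀ d ∈ D.1, d < K) : Fr P :=
  ⟨insert K D.1, Set.insert_nonempty _ _, D.2.2.insert fun d hd _ => Or.inr (h d hd).le⟩

theorem le_snoc (D : Fr P) (K : P) (h : ∀ d ∈ D.1, d < K) : D ≤ snoc D K h :=
  ⟨Set.subset_insert _ _, fun i hi j hj => by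
    obtain rfl | hj' := hj.1
    · exact h i hi
    · exact absurd hj' hj.2⟩

theorem ncard_snoc [Finite P] (D : Fr P) (K : P) (h : ∀ d ∈ D.1, d < K) :
    (snoc D K h).1.ncard = D.1.ncard + 1 :=
  Set.ncard_insert_of_notMem fun hK => (h K hK).false

theorem exists_max [Finite P] (C : Fr P) : ∃ K ∈ C.1, ∀ d ∈ C.1, d ≤ K := by
  obtain ⟨K, hK⟩ := (Set.toFinite C.1).exists_maximal C.2.1
  exact ⟨K, hK.prop, fun d hd => (C.2.2.total hd hK.prop).elim id fun h => hK.le_of_ge hd h⟩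

theorem eq_single_or_eq_snoc [Finite P] (C : Fr P) :
    (∃ K, C = single K) ∨ ∃ D K h, C = snoc D K h := by
  obtain ⟨K, hK, hmax⟩ := C.exists_max
  have hins : insert K (C.1 \ {K}) = C.1 := Set.insert_sdiff_self_of_mem hK
  by_cases hne : (C.1 \ {K}).Nonempty
  · refine Or.inr ⟨⟨C.1 \ {K}, hne, C.2.2.mono Set.sdiff_subset⟩, K, ?_, Subtype.ext hins.symm⟩
    exact fun d hd => lt_of_le_of_ne (hmax d hd.1) hd.2
  · refine Or.inl ⟨K, Subtype.ext ?_⟩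
    rw [Set.not_nonempty_iff_eq_empty.mp hne] at hins
    rw [← hins]
    exact insert_empty_eq K

theorem snoc_injective {D D' : Fr P} {K K' : P} {h h'} (e : snoc D K h = snoc D' K' h') :
    D = D' ∧ K = K' := by
  have e1 : insert K D.1 = insert K' D'.1 := congrArg Subtype.val e
  have hK : K = K' := by
    have h1 : K ∈ insert K' D'.1 := e1 ▸ Set.mem_insert _ _
    have h2 : K' ∈ insert K D.1 := e1 ▸ Set.mem_insert _ _
    rcases h1 with h1 | h1
    · exact h1
    · rcases h2 with h2 | h2
      · exact h2.symm
      · exact absurd (h' K h1) (h K' h2).asymm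
  subst hK
  refine ⟨Subtype.ext ?_, rfl⟩
  have hD : K ∉ D.1 := fun hm => (h K hm).false
  have hD' : K ∉ D'.1 := fun hm => (h' K hm).false
  rw [← Set.insert_sdiff_self_of_notMem hD, e1, Set.insert_sdiff_self_of_notMem hD']

theorem snoc_ne_single {D : Fr P} {K K' : P} {h} : snoc D K h ≠ single K' := by
  intro e
  have e1 : insert K D.1 = {K'} := congrArg Subtype.val e
  obtain ⟨d, hd⟩ := D.2.1
  have h1 : K = K' := by
    have : K ∈ ({K'} : Set P) := e1 ▸ Set.mem_insert _ _
    exact this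
  have h2 : d = K' := by
    have : d ∈ ({K'} : Set P) := e1 ▸ Set.mem_insert_of_mem _ hd
    exact this
  exact (h d hd).ne (h2.trans h1.symm)

@[elab_as_elim]
theorem induction [Finite P] {motive : Fr P → Prop} (h1 : ∀ K, motive (single K))
    (h2 : ∀ D K h, motive D → motive (snoc D K h)) (C : Fr P) : motive C := by
  induction hn : C.1.ncard using Nat.strong_induction_on generalizing C with
  | _ n ih =>
    obtain ⟨K, rfl⟩ | ⟨D, K, h, rfl⟩ := C.eq_single_or_eq_snoc
    · exact h1 K
    · exact h2 D K h (ih _ (by rw [← hn, ncard_snoc]; omega) D rfl)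

open Classical in
/-- Recursion along `single` and `snoc`. -/
theorem exists_recursion [Finite P] {U : Type*} (b : Fr P → U) (F : Fr P → U → U) :
    ∃ r : Fr P → U, (∀ K, r (single K) = b (single K)) ∧
      ∀ D K h, r (snoc D K h) = F (snoc D K h) (r D) := by
  let r : Fr P → U := WellFounded.fix (C := fun _ => U)
    (measure fun C : Fr P => C.1.ncard).wf fun C rec =>
      if hC : ∃ D K h, C = snoc D K h then
        F C (rec hC.choose (by
          obtain ⟨K, h, e⟩ := hC.choose_spec
          change hC.choose.1.ncard < C.1.ncard
          conv_rhs => rw [e, ncard_snoc]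
          exact Nat.lt_succ_self _))
      else b C
  refine ⟨r, fun K => ?_, fun D K h => ?_⟩
  · have hC : ¬ ∃ D K' h, single K = snoc D K' h := by
      rintro ⟨D, K', h, e⟩
      exact snoc_ne_single e.symm
    simp only [r]
    rw [WellFounded.fix_eq, dif_neg hC]
  · have hC : ∃ D' K' h', snoc D K h = snoc D' K' h' := ⟨D, K, h, rfl⟩
    have hD : hC.choose = D := by
      obtain ⟨K', h', e⟩ := hC.choose_spec
      exact (snoc_injective e).1.symm
    simp only [r]
    rw [WellFounded.fix_eq, dif_pos hC]
    exact congrArg (fun D' => F (snoc D K h) (r D')) hD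

variable {M : Type*} [SMul M P] [CovariantClass M P HSMul.hSMul LE.le]

theorem smul_single (a : M) (K : P) : a • single K = single (a • K) :=
  Subtype.ext Set.image_singleton

/-- The action is only weakly monotone, so the new top may merge with the image of the old one. This
collapse is why the products along chains below need idempotent values. -/
theorem smul_snoc (a : M) (D : Fr P) (K : P) (h : ∀ d ∈ D.1, d < K) :
    a • snoc D K h = a • D ∨ ∃ h', a • snoc D K h = snoc (a • D) (a • K) h' := by
  have e : (a • snoc D K h).1 = insert (a • K) (a • D).1 := Set.image_insert_eq
  by_cases hK : a • K ∈ (a • D).1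
  · exact Or.inl (Subtype.ext (e.trans (Set.insert_eq_of_mem hK)))
  · refine Or.inr ⟨?_, Subtype.ext e⟩
    rintro _ ⟨d, hd, rfl⟩
    refine lt_of_le_of_ne (CovariantClass.elim a (h d hd).le) fun e' => hK ?_
    exact ⟨d, hd, e'⟩

end

end Fr

/-! ### Equivariant order-reversing maps into compact right topological semigroups -/

section Equivariant

variable {P : Type*} [PartialOrder P] [Finite P] {M : Type*} [SMul M P]
  [CovariantClass M P HSMul.hSMul LE.le]
  {U : Type*} [Semigroup U] [SMul M U]

/-- The product, in increasing order, of the values of an equivariant idempotent-valued map along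
the initial segments of a chain is again equivariant. -/
theorem exists_leftProduct (hmul : ∀ (a : M) (x y : U), a • (x * y) = a • x * a • y)
    (g : Fr P → U) (hg : ∀ (a : M) C, g (a • C) = a • g C) (hid : ∀ C, g C * g C = g C) :
    ∃ r : Fr P → U, (∀ K, r (Fr.single K) = g (Fr.single K)) ∧
      (∀ D K h, r (Fr.snoc D K h) = r D * g (Fr.snoc D K h)) ∧
      ∀ (a : M) C, r (a • C) = a • r C := by
  obtain ⟨r, h1, h2⟩ := Fr.exists_recursion g fun C x => x * g C
  -- The outermost factor is `g C`, an idempotent. When the action collapses the new top, the extra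
  -- factor is thus swallowed.
  have absorb : ∀ C, r C * g C = r C := by
    intro C
    induction C using Fr.induction with
    | h1 K => rw [h1, hid]
    | h2 D K h _ => rw [h2, mul_assoc, hid]
  refine ⟨r, h1, h2, fun a C => ?_⟩
  induction C using Fr.induction with
  | h1 K => rw [h1, Fr.smul_single, h1, ← hg, Fr.smul_single]
  | h2 D K h ih =>
    rw [h2, hmul, ← ih, ← hg]
    obtain e | ⟨h', e⟩ := Fr.smul_snoc a D K h
    · rw [e, absorb]
    · rw [e, h2]

/-- The product, in decreasing order, of the values of an equivariant idempotent-valued map along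
the initial segments of a chain is again equivariant. -/
theorem exists_rightProduct (hmul : ∀ (a : M) (x y : U), a • (x * y) = a • x * a • y)
    (g : Fr P → U) (hg : ∀ (a : M) C, g (a • C) = a • g C) (hid : ∀ C, g C * g C = g C) :
    ∃ r : Fr P → U, (∀ K, r (Fr.single K) = g (Fr.single K)) ∧
      (∀ D K h, r (Fr.snoc D K h) = g (Fr.snoc D K h) * r D) ∧
      ∀ (a : M) C, r (a • C) = a • r C := by
  obtain ⟨r, h1, h2⟩ := Fr.exists_recursion g fun C x => g C * x
  have absorb : ∀ C, g C * r C = r C := by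
    intro C
    induction C using Fr.induction with
    | h1 K => rw [h1, hid]
    | h2 D K h _ => rw [h2, ← mul_assoc, hid]
  refine ⟨r, h1, h2, fun a C => ?_⟩
  induction C using Fr.induction with
  | h1 K => rw [h1, Fr.smul_single, h1, ← hg, Fr.smul_single]
  | h2 D K h ih =>
    rw [h2, hmul, ← ih, ← hg]
    obtain e | ⟨h', e⟩ := Fr.smul_snoc a D K h
    · rw [e, absorb]
    · rw [e, h2]

variable [TopologicalSpace U] [CompactSpace U] [T2Space U]

theorem exists_idempotent_of_isClosed {V : Type*} [Semigroup V] [TopologicalSpace V]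
    [CompactSpace V] [T2Space V] (hright : ∀ s : V, Continuous (· * s)) {A : Set V}
    (hA : IsClosed A) (hne : A.Nonempty) (hmul : ∀ x ∈ A, ∀ y ∈ A, x * y ∈ A) :
    ∃ x ∈ A, x * x = x :=
  exists_idempotent_in_compact_subsemigroup hright A hne hA.isCompact hmul

/-- From one equivariant map whose values on the chains in `T` lie in the closed two-sided ideal `I`
one obtains such a map which is moreover idempotent-valued and order reversing. The bound `m` on the
size of the chains serves the induction. -/
theorem exists_orderReversing_of_ncard_le (hright : ∀ s : U, Continuous (· * s))
    (hcont : ∀ a : M, Continuous fun x : U => a • x)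
    (hmul : ∀ (a : M) (x y : U), a • (x * y) = a • x * a • y)
    {I : Set U} (hI : IsClosed I) (hIl : ∀ x, ∀ i ∈ I, x * i ∈ I) (hIr : ∀ x, ∀ i ∈ I, i * x ∈ I)
    (T : Set (Fr P)) (g₀ : Fr P → U) (hg₀ : ∀ (a : M) C, g₀ (a • C) = a • g₀ C)
    (hT₀ : ∀ C ∈ T, g₀ C ∈ I) (m : ℕ) :
    ∃ g : Fr P → U, (∀ (a : M) C, g (a • C) = a • g C) ∧ (∀ C ∈ T, g C ∈ I) ∧
      (∀ C, C.1.ncard ≤ m → g C * g C = g C) ∧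
      ∀ D K h, (Fr.snoc D K h).1.ncard ≤ m →
        g D * g (Fr.snoc D K h) = g (Fr.snoc D K h) ∧
        g (Fr.snoc D K h) * g D = g (Fr.snoc D K h) := by
  induction m with
  | zero =>
    have hpos : ∀ C : Fr P, ¬ C.1.ncard ≤ 0 := fun C hC =>
      C.2.1.ne_empty ((Set.ncard_eq_zero (Set.toFinite _)).mp (Nat.le_zero.mp hC))
    exact ⟨g₀, hg₀, hT₀, fun C hC => absurd hC (hpos C), fun D K h hC => absurd hC (hpos _)⟩
  | succ m ih =>
    obtain ⟨g, hg, hT, hid, hord⟩ := ih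
    -- Maps into `U` are multiplied pointwise. Those that are equivariant and extend the part of `g`
    -- already built form a closed subsemigroup `G₀`, because that part is idempotent.
    have hrightPi : ∀ s : Fr P → U, Continuous (· * s) := fun s =>
      continuous_pi fun C => (hright (s C)).comp (continuous_apply C)
    let G₀ : Set (Fr P → U) := {x | (∀ (a : M) C, x (a • C) = a • x C) ∧ (∀ C ∈ T, x C ∈ I) ∧
      ∀ C, C.1.ncard ≤ m → x C = g C}
    have hG₀ : IsClosed G₀ := by
      simp only [G₀, Set.ofPred_and, Set.ofPred_forall]
      refine IsClosed.inter ?_ (IsClosed.inter ?_ ?_)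
      · exact isClosed_iInter fun a => isClosed_iInter fun C =>
          isClosed_eq (continuous_apply _) ((hcont a).comp (continuous_apply _))
      · exact isClosed_iInter fun C => isClosed_iInter fun _ => hI.preimage (continuous_apply C)
      · exact isClosed_iInter fun C => isClosed_iInter fun _ =>
          isClosed_eq (continuous_apply _) continuous_const
    have hG₀mul : ∀ x ∈ G₀, ∀ y ∈ G₀, x * y ∈ G₀ := by
      rintro x ⟨x1, x2, x3⟩ y ⟨y1, y2, y3⟩
      refine ⟨fun a C => ?_, fun C hC => hIl _ _ (y2 C hC), fun C hC => ?_⟩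
      · simp only [Pi.mul_apply, x1, y1, hmul]
      · simp only [Pi.mul_apply, x3 C hC, y3 C hC, hid C hC]
    obtain ⟨g₁, ⟨h11, h12, h13⟩, hg₁⟩ := exists_idempotent_of_isClosed hrightPi hG₀
      ⟨g, hg, hT, fun _ _ => rfl⟩ hG₀mul
    -- This product ends on the right with the values at smaller chains, which gives `r C * g D = r
    -- C` and makes `G₀ ∩ G₁` nonempty.
    obtain ⟨r, hr1, hr2, hr⟩ := exists_rightProduct hmul g₁ h11 (congrFun hg₁)
    have hrT : ∀ C ∈ T, r C ∈ I := by
      intro C hC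
      obtain ⟨K, rfl⟩ | ⟨D, K, h, rfl⟩ := C.eq_single_or_eq_snoc
      · exact hr1 K ▸ h12 _ hC
      · exact hr2 D K h ▸ hIr _ _ (h12 _ hC)
    have hrg : ∀ C : Fr P, C.1.ncard ≤ m → r C = g C := by
      intro C
      induction C using Fr.induction with
      | h1 K => exact fun hC => (hr1 K).trans (h13 _ hC)
      | h2 D K h ih =>
        intro hC
        have hD : D.1.ncard ≤ m := by rw [Fr.ncard_snoc] at hC; omega
        rw [hr2, h13 _ hC, ih hD, (hord D K h hC).2]
    -- Only this one-sided condition is visibly closed, since only right multiplications are assumed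
    -- continuous. The condition on the other side comes from a final left product, which preserves
    -- this one.
    let G₁ : Set (Fr P → U) := {x | ∀ D K h, (Fr.snoc D K h).1.ncard ≤ m + 1 →
      x (Fr.snoc D K h) * g D = x (Fr.snoc D K h)}
    have hG₁ : IsClosed G₁ := by
      simp only [G₁, Set.ofPred_forall]
      exact isClosed_iInter fun D => isClosed_iInter fun K => isClosed_iInter fun h =>
        isClosed_iInter fun _ => isClosed_eq
          ((hright (g D)).comp (continuous_apply _)) (continuous_apply _)
    have hG₁mul : ∀ x ∈ G₁, ∀ y ∈ G₁, x * y ∈ G₁ := by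
      intro x hx y hy D K h hC
      simp only [Pi.mul_apply, mul_assoc, hy D K h hC]
    have hrG₁ : r ∈ G₁ := by
      intro D K h hC
      have hD : D.1.ncard ≤ m := by rw [Fr.ncard_snoc] at hC; omega
      rw [hr2, hrg D hD, mul_assoc, hid D hD]
    obtain ⟨g₂, ⟨⟨h21, h22, h23⟩, h24⟩, hg₂⟩ := exists_idempotent_of_isClosed hrightPi
      (hG₀.inter hG₁) ⟨r, ⟨hr, hrT, hrg⟩, hrG₁⟩
      fun x hx y hy => ⟨hG₀mul x hx.1 y hy.1, hG₁mul x hx.2 y hy.2⟩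
    obtain ⟨f, hf1, hf2, hf⟩ := exists_leftProduct hmul g₂ h21 (congrFun hg₂)
    have hfg : ∀ C : Fr P, C.1.ncard ≤ m → f C = g C := by
      intro C
      induction C using Fr.induction with
      | h1 K => exact fun hC => (hf1 K).trans (h23 _ hC)
      | h2 D K h ih =>
        intro hC
        have hD : D.1.ncard ≤ m := by rw [Fr.ncard_snoc] at hC; omega
        rw [hf2, h23 _ hC, ih hD, (hord D K h hC).1]
    have hfs : ∀ D K h, (Fr.snoc D K h).1.ncard ≤ m + 1 →
        f D = g D ∧ g D * g D = g D ∧ f (Fr.snoc D K h) = g D * g₂ (Fr.snoc D K h) ∧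
        g₂ (Fr.snoc D K h) * g D = g₂ (Fr.snoc D K h) := by
      intro D K h hC
      have hD : D.1.ncard ≤ m := by rw [Fr.ncard_snoc] at hC; omega
      exact ⟨hfg D hD, hid D hD, by rw [hf2, hfg D hD], h24 D K h hC⟩
    refine ⟨f, hf, fun C hC => ?_, fun C hC => ?_, fun D K h hC => ?_⟩
    · obtain ⟨K, rfl⟩ | ⟨D, K, h, rfl⟩ := C.eq_single_or_eq_snoc
      · exact hf1 K ▸ h22 _ hC
      · exact hf2 D K h ▸ hIl _ _ (h22 _ hC)
    · obtain ⟨K, rfl⟩ | ⟨D, K, h, rfl⟩ := C.eq_single_or_eq_snoc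
      · rw [hf1]
        exact congrFun hg₂ _
      -- With `x = g₂ C` one has `f C = g D * x` and `x * g D = x`, so `f C` is idempotent because
      -- `x` is.
      · obtain ⟨-, -, e, e'⟩ := hfs D K h hC
        rw [e, mul_assoc, ← mul_assoc (g₂ _), e']
        exact congrArg (g D * ·) (congrFun hg₂ _)
    · obtain ⟨e1, e2, e3, e4⟩ := hfs D K h hC
      rw [e1, e3]
      exact ⟨by rw [← mul_assoc, e2], by rw [mul_assoc, e4]⟩

/-- No chain has more than `Nat.card P` elements, so the size bound disappears; relations for
one-step extensions compose to give all `D ≤ C`. -/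
theorem exists_orderReversing (hright : ∀ s : U, Continuous (· * s))
    (hcont : ∀ a : M, Continuous fun x : U => a • x)
    (hmul : ∀ (a : M) (x y : U), a • (x * y) = a • x * a • y)
    {I : Set U} (hI : IsClosed I) (hIl : ∀ x, ∀ i ∈ I, x * i ∈ I) (hIr : ∀ x, ∀ i ∈ I, i * x ∈ I)
    (T : Set (Fr P)) (g₀ : Fr P → U) (hg₀ : ∀ (a : M) C, g₀ (a • C) = a • g₀ C)
    (hT₀ : ∀ C ∈ T, g₀ C ∈ I) :
    ∃ g : Fr P → U, (∀ (a : M) C, g (a • C) = a • g C) ∧ (∀ C ∈ T, g C ∈ I) ∧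
      ∀ D C, D ≤ C → g D * g C = g C ∧ g C * g D = g C := by
  obtain ⟨g, hg, hT, hid, hord⟩ := exists_orderReversing_of_ncard_le hright hcont hmul hI hIl hIr
    T g₀ hg₀ hT₀ (Nat.card P)
  have hcard : ∀ C : Fr P, C.1.ncard ≤ Nat.card P := fun C => Set.ncard_le_card _
  refine ⟨g, hg, hT, fun D C hDC => ?_⟩
  induction C using Fr.induction with
  | h1 K =>
    have : D = Fr.single K := by
      apply Subtype.ext
      exact (Set.subset_singleton_iff_eq.mp hDC.1).resolve_left D.2.1.ne_empty
    rw [this]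
    exact ⟨hid _ (hcard _), hid _ (hcard _)⟩
  | h2 E K h ih =>
    obtain ⟨e1, e2⟩ := hord E K h (hcard _)
    by_cases hK : K ∈ D.1
    · have : D = Fr.snoc E K h := by
        apply Subtype.ext
        refine hDC.1.antisymm fun j hj => ?_
        by_contra hjD
        have hlt := hDC.2 K hK j ⟨hj, hjD⟩
        obtain rfl | hjE := hj
        · exact hlt.false
        · exact hlt.asymm (h j hjE)
      rw [this]
      exact ⟨hid _ (hcard _), hid _ (hcard _)⟩
    · have hDE : D ≤ E := by
        refine ⟨fun d hd => (hDC.1 hd).resolve_left ?_, fun i hi j hj =>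
          hDC.2 i hi j ⟨Or.inr hj.1, hj.2⟩⟩
        rintro rfl
        exact hK hd
      obtain ⟨i1, i2⟩ := ih hDE
      constructor
      · rw [← e1, ← mul_assoc, i1]
      · rw [← e2, mul_assoc, i2]

end Equivariant

/-! ### Minimal idempotents and the action of R-classes -/

section

variable {U : Type*} [Semigroup U] [TopologicalSpace U] [CompactSpace U] [T2Space U]

/-- A closed subsemigroup contains an idempotent which is minimal among its idempotents. -/
theorem exists_minimal_idempotent (hright : ∀ s : U, Continuous (· * s)) {A : Set U}
    (hA : IsClosed A) (hne : A.Nonempty) (hmul : ∀ x ∈ A, ∀ y ∈ A, x * y ∈ A) :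
    ∃ v ∈ A, v * v = v ∧ ∀ f ∈ A, f * f = f → f * v = f → v * f = f → f = v := by
  -- The closed left ideals of `A`. The required idempotent `v` is taken in a minimal one, `L`.
  let S : Set (Set U) :=
    {L | L ⊆ A ∧ IsClosed L ∧ L.Nonempty ∧ ∀ x ∈ A, ∀ y ∈ L, x * y ∈ L}
  have hAS : A ∈ S := ⟨subset_rfl, hA, hne, hmul⟩
  obtain ⟨L, -, hL⟩ := zorn_superset_nonempty S (fun c hcs hc hcne => by
    refine ⟨⋂₀ c, ⟨?_, isClosed_sInter fun t ht => (hcs ht).2.1, ?_, fun x hx y hy t ht =>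
      (hcs ht).2.2.2 x hx y (hy t ht)⟩, fun s hs => Set.sInter_subset_of_mem hs⟩
    · obtain ⟨t, ht⟩ := hcne
      exact (Set.sInter_subset_of_mem ht).trans (hcs ht).1
    · have := hcne.coe_sort
      rw [Set.sInter_eq_iInter]
      exact IsCompact.nonempty_iInter_of_directed_nonempty_isCompact_isClosed _
        (DirectedOn.directed_val (IsChain.directedOn hc.symm))
        (fun i => (hcs i.2).2.2.1) (fun i => (hcs i.2).2.1.isCompact) fun i => (hcs i.2).2.1) A hAS
  obtain ⟨hLA, hLc, hLne, hLmul⟩ := hL.prop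
  obtain ⟨v, hvL, hv⟩ := exists_idempotent_of_isClosed hright hLc hLne
    fun x hx y hy => hLmul x (hLA hx) y hy
  refine ⟨v, hLA hvL, hv, fun f hfA hf hfv hvf => ?_⟩
  have hfL : f ∈ L := hfv ▸ hLmul f hfA v hvL
  -- `A f` is a closed left ideal inside `L`, hence contains `v`. So `v = x * f`, whence `v * f =
  -- v`, while `v * f = f`.
  have himg : (· * f) '' A ∈ S := by
    refine ⟨?_, (hright f).isClosedMap _ hA, hne.image _, ?_⟩
    · rintro _ ⟨x, hx, rfl⟩
      exact hmul x hx f hfA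
    · rintro x hx _ ⟨y, hy, rfl⟩
      exact ⟨x * y, hmul x hx y hy, mul_assoc _ _ _⟩
  have hsub : (· * f) '' A ⊆ L := by
    rintro _ ⟨x, hx, rfl⟩
    exact hLmul x hx f hfL
  obtain ⟨x, -, hx⟩ := hL.le_of_le himg hsub hvL
  have hx' : x * f = v := hx
  rw [← hvf, ← hx', mul_assoc, hf]

variable {M : Type*} [Monoid M] [MulAction M U]

/-- A closed ideal contains an element on which `R`-equivalent elements of an almost `R`-trivial
monoid act in the same way. -/
theorem exists_mem_smul_eq_smul (hM : AlmostRTrivial M) (hright : ∀ s : U, Continuous (· * s))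
    (hcont : ∀ a : M, Continuous fun x : U => a • x)
    (hmul : ∀ (a : M) (x y : U), a • (x * y) = a • x * a • y)
    {I : Set U} (hI : IsClosed I) (hIl : ∀ x, ∀ i ∈ I, x * i ∈ I) (hIr : ∀ x, ∀ i ∈ I, i * x ∈ I)
    (hne : I.Nonempty) :
    ∃ u ∈ I, ∀ a b : M, rightIdeal a = rightIdeal b → a • u = b • u := by
  -- Without such a `z` all R-classes are singletons, and any point of the ideal will do.
  by_cases hR : ∃ z : M, ∀ a, a * z = z
  · obtain ⟨z, hz⟩ := hR
    obtain ⟨i, hi⟩ := hne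
    let A : Set U := {x | ∀ a : M, a • x = x}
    have hA : IsClosed A := by
      simp only [A, Set.ofPred_forall]
      exact isClosed_iInter fun a => isClosed_eq (hcont a) continuous_id
    obtain ⟨v, hvA, hv, hvmin⟩ := exists_minimal_idempotent hright hA
      ⟨z • i, fun a => by rw [smul_smul, hz]⟩
      fun x hx y hy a => by rw [hmul, hx a, hy a]
    -- An idempotent of `I` with `e * v = e`; then `v * e` is an idempotent of `I` below `v`.
    obtain ⟨e, ⟨heI, hev⟩, he⟩ := exists_idempotent_of_isClosed hright
      (A := I ∩ {x | x * v = x}) (hI.inter (isClosed_eq (hright v) continuous_id))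
      ⟨i * v, hIr _ _ hi, by rw [Set.mem_ofPred_eq, mul_assoc, hv]⟩
      fun x hx y hy => ⟨hIl _ _ hy.1, by
        have := hy.2
        rw [Set.mem_ofPred_eq] at this ⊢
        rw [mul_assoc, this]⟩
    rw [Set.mem_ofPred_eq] at hev
    -- Such an `a` sends `v * e` to an `M`-fixed idempotent, still below `a • v = v`. Minimality of
    -- `v` forces equality, so all these `a` agree on `v * e`.
    have hzero : ∀ a : M, (∀ c, c * a = a) → a • (v * e) = v := by
      intro a ha
      have hav : a • v = v := hvA a
      refine hvmin _ (fun c => by rw [smul_smul, ha]) ?_ ?_ ?_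
      · rw [← hmul, mul_assoc, ← mul_assoc e, hev, he]
      · conv_lhs => rw [← hav, ← hmul, hav, mul_assoc, hev]
      · conv_lhs => rw [← hav, ← hmul, hav, ← mul_assoc, hv]
    refine ⟨v * e, hIl _ _ heI, fun a b hab => ?_⟩
    by_cases h : a = b
    · rw [h]
    · rw [hzero a (hM a b (Ne.symm h) hab.symm), hzero b (hM b a h hab)]
  · obtain ⟨u, hu⟩ := hne
    refine ⟨u, hu, fun a b hab => ?_⟩
    by_contra h
    have hne : b ≠ a := fun h' => h (by rw [h'])
    exact hR ⟨a, hM a b hne hab.symm⟩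

end

/-! ### Equivariant maps on chains of principal right ideals -/

section

variable {M : Type*} [Monoid M]

instance [Finite M] : Finite (XX M) :=
  inferInstanceAs (Finite {I : Set M // ∃ a : M, I = rightIdeal a})

theorem image_mul_rightIdeal (a k : M) :
    (fun c => a * c) '' rightIdeal k = rightIdeal (a * k) := by
  ext c
  constructor
  · rintro ⟨_, ⟨d, rfl⟩, rfl⟩
    exact ⟨d, (mul_assoc a k d).symm⟩
  · rintro ⟨d, rfl⟩
    exact ⟨k * d, ⟨d, rfl⟩, (mul_assoc a k d).symm⟩

/-- The largest element `M` of `𝕏(M)`. -/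
def XX.top (M : Type*) [Monoid M] : XX M := ⟨rightIdeal 1, 1, rfl⟩

theorem XX.le_top (K : XX M) : K ≤ XX.top M := fun c _ => ⟨c, (one_mul c).symm⟩

/-- Otherwise the ideal `M` could be added on top, giving a proper end-extension. -/
theorem XX.top_mem_of_isMax {y : YY M} (hy : IsMax y) : XX.top M ∈ y.1 := by
  by_contra h
  have hlt : ∀ d ∈ y.1, d < XX.top M := fun d hd =>
    lt_of_le_of_ne d.le_top fun e => h (e ▸ hd)
  exact h ((hy (y.le_snoc _ hlt)).1 (Set.mem_insert _ _))

/-- An element on which `R`-equivalent elements act in the same way gives an equivariant map. -/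
theorem exists_equivariant [Finite M] {U : Type*} [MulAction M U] (u : U)
    (hu : ∀ a b : M, rightIdeal a = rightIdeal b → a • u = b • u) :
    ∃ g : YY M → U, (∀ (a : M) C, g (a • C) = a • g C) ∧ ∀ C : YY M, XX.top M ∈ C.1 → g C = u := by
  have hmax : ∀ C : YY M, ∃ k : M, (∃ K ∈ C.1, K.1 = rightIdeal k) ∧
      ∀ K ∈ C.1, K.1 ⊆ rightIdeal k := by
    intro C
    obtain ⟨K, hK, hle⟩ := C.exists_max
    obtain ⟨k, hk⟩ := K.2
    exact ⟨k, ⟨K, hK, hk⟩, fun J hJ => hk ▸ hle J hJ⟩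
  choose k hk hle using hmax
  refine ⟨fun C => k C • u, fun a C => ?_, fun C hC => ?_⟩
  · change k (a • C) • u = a • k C • u
    rw [smul_smul]
    -- The maximum of `a • C` is `a` times the maximum of `C`, so the two chosen generators are
    -- R-equivalent.
    apply hu
    apply Set.Subset.antisymm
    · obtain ⟨_, ⟨J, hJ, rfl⟩, e⟩ := hk (a • C)
      rw [← e, ← image_mul_rightIdeal]
      exact Set.image_mono (hle C J hJ)
    · obtain ⟨J, hJ, e⟩ := hk C
      rw [← image_mul_rightIdeal, ← e]
      exact hle (a • C) (a • J) ⟨J, hJ, rfl⟩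
  · refine (hu _ 1 ?_).trans (one_smul M u)
    exact Set.Subset.antisymm (fun c _ => ⟨c, (one_mul c).symm⟩) (hle C _ hC)

end

attribute [local instance] Ultrafilter.mul Ultrafilter.semigroup

open Filter

/-! ### Ultrafilters on located words -/

section Located

/-- Located words: `(n, b)` stands for the letter `b x_n`, with `x_n` the `n`-th distinguished
point. -/
abbrev LocWord (M : Type*) : Type _ := FreeMonoid (ℕ × M)

variable {M : Type*}

/-- The locations are strictly increasing. -/
def Increasing (t : LocWord M) : Prop := t.toList.Pairwise fun p q => p.1 < q.1

theorem increasing_mul {s t : LocWord M} : Increasing (s * t) ↔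
    Increasing s ∧ Increasing t ∧ ∀ p ∈ s.toList, ∀ q ∈ t.toList, p.1 < q.1 := by
  simp only [Increasing, FreeMonoid.toList_mul, List.pairwise_append]

theorem exists_location_bound (t : LocWord M) : ∃ B : ℕ, ∀ p ∈ t.toList, p.1 < B := by
  obtain ⟨B, hB⟩ := (t.toList.map Prod.fst).toFinset.bddAbove
  refine ⟨B + 1, fun p hp => Nat.lt_succ_of_le (hB ?_)⟩
  simpa using ⟨p.2, hp⟩

variable [Monoid M]

/-- Left translation of all letters. -/
def translate (a : M) : LocWord M →* LocWord M := FreeMonoid.map fun p => (p.1, a * p.2)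

theorem toList_translate (a : M) (t : LocWord M) :
    (translate a t).toList = t.toList.map fun p => (p.1, a * p.2) := rfl

theorem translate_one (t : LocWord M) : translate 1 t = t := by
  apply FreeMonoid.toList.injective
  simp [toList_translate]

theorem translate_mul (a b : M) (t : LocWord M) :
    translate (a * b) t = translate a (translate b t) := by
  apply FreeMonoid.toList.injective
  simp [toList_translate, mul_assoc]

theorem increasing_translate {a : M} {t : LocWord M} :
    Increasing (translate a t) ↔ Increasing t := by
  simp [Increasing, toList_translate, List.pairwise_map]

/-- The increasing located words all of whose locations are at least `N`. -/
def tailWords (M : Type*) [Monoid M] (N : ℕ) : Set (LocWord M) :=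
  {t | Increasing t ∧ ∀ p ∈ t.toList, N ≤ p.1}

theorem translate_mem_tailWords {a : M} {N : ℕ} {t : LocWord M} (ht : t ∈ tailWords M N) :
    translate a t ∈ tailWords M N := by
  refine ⟨increasing_translate.mpr ht.1, fun p hp => ?_⟩
  rw [toList_translate, List.mem_map] at hp
  obtain ⟨q, hq, rfl⟩ := hp
  exact ht.2 q hq

/-- The ultrafilters on located words which concentrate on every set `tailWords M N`. -/
def CofUltra (M : Type*) [Monoid M] : Type _ :=
  {u : Ultrafilter (LocWord M) // ∀ N, tailWords M N ∈ u}

theorem tailWords_mem_mul {u v : Ultrafilter (LocWord M)} (hu : ∀ N, tailWords M N ∈ u)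
    (hv : ∀ N, tailWords M N ∈ v) (N : ℕ) : tailWords M N ∈ u * v := by
  refine (Ultrafilter.eventually_mul u v (· ∈ tailWords M N)).mpr ?_
  filter_upwards [hu N] with s hs
  -- Once `s` is fixed, almost every `t` is located entirely beyond it.
  obtain ⟨B, hB⟩ := exists_location_bound s
  filter_upwards [hv N, hv B] with t ht htB
  refine ⟨increasing_mul.mpr ⟨hs.1, ht.1, fun p hp q hq => (hB p hp).trans_le (htB.2 q hq)⟩, ?_⟩
  intro p hp
  rw [FreeMonoid.toList_mul, List.mem_append] at hp
  exact hp.elim (hs.2 p) (ht.2 p)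

instance : Semigroup (CofUltra M) where
  mul u v := ⟨u.1 * v.1, tailWords_mem_mul u.2 v.2⟩
  mul_assoc u v w := Subtype.ext (mul_assoc u.1 v.1 w.1)

instance : MulAction M (CofUltra M) where
  smul a u := ⟨u.1.map (translate a), fun N => by
    rw [Ultrafilter.mem_map]
    exact mem_of_superset (u.2 N) fun t ht => translate_mem_tailWords ht⟩
  one_smul u := Subtype.ext (by
    change u.1.map (translate 1) = u.1
    rw [show (translate 1 : LocWord M → LocWord M) = id from funext translate_one,
      Ultrafilter.map_id])
  mul_smul a b u := Subtype.ext (by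
    change u.1.map (translate (a * b)) = (u.1.map (translate b)).map (translate a)
    rw [Ultrafilter.map_map]
    exact congrArg (fun f => u.1.map f) (funext (translate_mul a b)))

instance : TopologicalSpace (CofUltra M) :=
  inferInstanceAs (TopologicalSpace {u : Ultrafilter (LocWord M) // ∀ N, tailWords M N ∈ u})

instance : T2Space (CofUltra M) :=
  inferInstanceAs (T2Space {u : Ultrafilter (LocWord M) // ∀ N, tailWords M N ∈ u})

instance : CompactSpace (CofUltra M) := by
  have h : IsClosed {u : Ultrafilter (LocWord M) | ∀ N, tailWords M N ∈ u} := by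
    simp only [Set.ofPred_forall]
    exact isClosed_iInter fun N => ultrafilter_isClosed_basic (tailWords M N)
  exact isCompact_iff_compactSpace.mp h.isCompact

theorem CofUltra.continuous_mul_left (v : CofUltra M) : Continuous (· * v) :=
  ((Ultrafilter.continuous_mul_left v.1).comp continuous_subtype_val).subtype_mk _

theorem continuous_ultrafilter_map {α β : Type*} (f : α → β) :
    Continuous (Ultrafilter.map f) :=
  ultrafilterBasis_is_basis.continuous_iff.2 <| Set.forall_mem_range.mpr fun s =>
    ultrafilter_isOpen_basic (f ⁻¹' s)

theorem CofUltra.continuous_smul (a : M) : Continuous fun u : CofUltra M => a • u :=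
  ((continuous_ultrafilter_map (translate a)).comp continuous_subtype_val).subtype_mk _

theorem CofUltra.smul_mul (a : M) (u v : CofUltra M) : a • (u * v) = a • u * a • v := by
  apply Subtype.ext
  apply Ultrafilter.coe_inj.mp
  refine Filter.ext fun s => ?_
  change (∀ᶠ x in u.1, ∀ᶠ y in v.1, translate a (x * y) ∈ s) ↔
    ∀ᶠ x in u.1, ∀ᶠ y in v.1, translate a x * translate a y ∈ s
  simp only [map_mul]

/-- The located words in which some letter is a distinguished point. -/
def pointedWords (M : Type*) [Monoid M] : Set (LocWord M) := {t | ∃ n, (n, (1 : M)) ∈ t.toList}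

/-- The ultrafilters concentrating on the words with a distinguished point. -/
def pointedIdeal (M : Type*) [Monoid M] : Set (CofUltra M) := {u | pointedWords M ∈ u.1}

theorem isClosed_pointedIdeal : IsClosed (pointedIdeal M) :=
  (ultrafilter_isClosed_basic (pointedWords M)).preimage continuous_subtype_val

theorem mul_mem_pointedIdeal_left (u : CofUltra M) :
    ∀ i ∈ pointedIdeal M, u * i ∈ pointedIdeal M := by
  intro i hi
  refine (Ultrafilter.eventually_mul u.1 i.1 (· ∈ pointedWords M)).mpr ?_
  refine Eventually.of_forall fun s => mem_of_superset hi ?_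
  rintro t ⟨n, hn⟩
  exact ⟨n, by rw [FreeMonoid.toList_mul]; exact List.mem_append_right _ hn⟩

theorem mul_mem_pointedIdeal_right (u : CofUltra M) :
    ∀ i ∈ pointedIdeal M, i * u ∈ pointedIdeal M := by
  intro i hi
  refine (Ultrafilter.eventually_mul i.1 u.1 (· ∈ pointedWords M)).mpr ?_
  refine mem_of_superset hi ?_
  rintro t ⟨n, hn⟩
  exact Eventually.of_forall fun s =>
    ⟨n, by rw [FreeMonoid.toList_mul]; exact List.mem_append_left _ hn⟩

/-- The one-letter words `(n, 1)`, pushed along a nonprincipal ultrafilter on `ℕ`. -/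
theorem pointedIdeal_nonempty : (pointedIdeal M).Nonempty := by
  let f : ℕ → LocWord M := fun n => FreeMonoid.of (n, 1)
  refine ⟨⟨(hyperfilter ℕ).map f, fun N => ?_⟩, ?_⟩
  · rw [Ultrafilter.mem_map]
    have h : {n | N ≤ n} ∈ hyperfilter ℕ := by
      apply mem_hyperfilter_of_finite_compl
      exact (Set.finite_lt_nat N).subset fun n hn => by
        simpa using hn
    refine mem_of_superset h fun n hn => ⟨?_, ?_⟩
    · simp [f, Increasing]
    · simpa [f] using hn
  · change f ⁻¹' pointedWords M ∈ hyperfilter ℕ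
    exact univ_mem' fun n => ⟨n, by simp [f]⟩

/-- An equivariant, order-reversing map of `𝕐(M)` into the semigroup of ultrafilters, sending the
chains with top `M` into the ideal of ultrafilters on pointed words. -/
theorem exists_equivariant_ultrafilters [Finite M] (hM : AlmostRTrivial M) :
    ∃ g : YY M → CofUltra M, (∀ (a : M) C, g (a • C) = a • g C) ∧
      (∀ C : YY M, XX.top M ∈ C.1 → g C ∈ pointedIdeal M) ∧
      ∀ D C, D ≤ C → g D * g C = g C ∧ g C * g D = g C := by
  obtain ⟨u, huI, hu⟩ := exists_mem_smul_eq_smul hM CofUltra.continuous_mul_left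
    CofUltra.continuous_smul CofUltra.smul_mul isClosed_pointedIdeal mul_mem_pointedIdeal_left
    mul_mem_pointedIdeal_right pointedIdeal_nonempty
  obtain ⟨g₀, hg₀, htop⟩ := exists_equivariant u hu
  exact exists_orderReversing CofUltra.continuous_mul_left CofUltra.continuous_smul
    CofUltra.smul_mul isClosed_pointedIdeal mul_mem_pointedIdeal_left mul_mem_pointedIdeal_right
    {C | XX.top M ∈ C.1} g₀ hg₀ fun C hC => (htop C hC).symm ▸ huI

end Located

/-! ### The recursive construction -/

section Construction

theorem exists_eventually_eq_of_finite {α κ : Type*} [Finite κ] (u : Ultrafilter α) (c : α → κ) :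
    ∃ k, ∀ᶠ t in (u : Filter α), c t = k := by
  obtain ⟨k, hk⟩ := Ultrafilter.eq_pure_of_finite (u.map c)
  refine ⟨k, ?_⟩
  have : {k} ∈ u.map c := by rw [hk]; exact Set.mem_singleton k
  exact this

/-- The product of the ultrafilters attached to the letters of a list. -/
def listUltra {Y T : Type*} [Monoid T] (g : Y → Ultrafilter T) (l : List Y) : Ultrafilter T :=
  l.foldr (fun p v => g p * v) (pure 1)

/-- Each absorption of a letter is matched by the corresponding relation for `g`, so products of
ultrafilters see only normal forms. -/
theorem listUltra_absorbCons {Y T : Type*} [PartialOrder Y] [Monoid T] {g : Y → Ultrafilter T}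
    (hg : ∀ D C, D ≤ C → g D * g C = g C ∧ g C * g D = g C) (p : Y) (l : List Y) :
    listUltra g (absorbCons p l) = g p * listUltra g l := by
  cases l with
  | nil => rfl
  | cons q t =>
    change _ = g p * (g q * listUltra g t)
    by_cases h1 : p ≤ q
    · simp only [absorbCons, h1, if_true]
      rw [← mul_assoc, (hg p q h1).1]
      rfl
    · by_cases h2 : q ≤ p
      · simp only [absorbCons, h1, h2, if_true, if_false]
        rw [← mul_assoc, (hg q p h2).2]
        rfl
      · simp only [absorbCons, h1, h2, if_false]
        rfl

variable {M : Type*} [Monoid M] [Finite M] {Y : Type*} [PartialOrder Y] [Finite Y] [SMul M Y]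
  {κ : Type*} {g : Y → Ultrafilter (LocWord M)} {c : LocWord M → κ} {φ : List Y → κ} {N : ℕ}

variable (g c φ N) in
/-- The states of the construction: a finite set of words located below `bound`, each with a list
of letters such that the words can be extended generically with the right colors. -/
structure Stage where
  words : Set (LocWord M × List Y)
  bound : ℕ
  finite : words.Finite
  increasing : ∀ x ∈ words, Increasing x.1
  lt_bound : ∀ x ∈ words, ∀ p ∈ x.1.toList, p.1 < bound
  color : ∀ x ∈ words, ∀ h : List Y, (x.2.foldr absorbCons h).length ≤ N →
    ∀ᶠ s in (listUltra g h : Filter (LocWord M)), c (x.1 * s) = φ (x.2.foldr absorbCons h)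

theorem Stage.exists_next (hg : ∀ D C, D ≤ C → g D * g C = g C ∧ g C * g D = g C)
    {y : Y} (hy : ∀ a : M, g (a • y) = (g y).map (translate a))
    (htail : ∀ N, tailWords M N ∈ g y) (hpt : pointedWords M ∈ g y) (s : Stage g c φ N) :
    ∃ (t : LocWord M) (s' : Stage g c φ N), t ∈ pointedWords M ∧ s.words ⊆ s'.words ∧
      ∀ x ∈ s.words, ∀ a : M, (x.1 * translate a t, x.2 ++ [a • y]) ∈ s'.words := by
  have hcol : ∀ᶠ t in (g y : Filter (LocWord M)), ∀ x ∈ s.words, ∀ a : M,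
      ∀ h ∈ {h : List Y | h.length ≤ N}, ((x.2 ++ [a • y]).foldr absorbCons h).length ≤ N →
        ∀ᶠ r in (listUltra g h : Filter (LocWord M)),
          c (x.1 * translate a t * r) = φ ((x.2 ++ [a • y]).foldr absorbCons h) := by
    -- Finitely many words, elements of `M` and tails of length at most `N`: the demands can be met
    -- by a single `t`.
    refine (eventually_all_finite s.finite).mpr fun x hx => eventually_all.mpr fun a =>
      (eventually_all_finite (List.finite_length_le Y N)).mpr fun h _ => ?_
    by_cases hlen : ((x.2 ++ [a • y]).foldr absorbCons h).length ≤ N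
    · have e : (x.2 ++ [a • y]).foldr absorbCons h =
          x.2.foldr absorbCons (absorbCons (a • y) h) := by simp
      -- The invariant for this longer tail concerns `g (a • y) * listUltra g h`. Its first factor
      -- is the image of `g y` under `translate a`, so the condition becomes one on `t`.
      have := s.color x hx (absorbCons (a • y) h) (e ▸ hlen)
      rw [listUltra_absorbCons hg, Ultrafilter.eventually_mul, hy, ← e] at this
      have this : ∀ᶠ t in (g y : Filter (LocWord M)), ∀ᶠ r in (listUltra g h : Filter (LocWord M)),
        c (x.1 * (translate a t * r)) = φ ((x.2 ++ [a • y]).foldr absorbCons h) := this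
      filter_upwards [this] with t ht _
      simpa only [mul_assoc] using ht
    · exact Eventually.of_forall fun t h' => absurd h' hlen
  obtain ⟨t, ht, htl, htp⟩ := (hcol.and (inter_mem (htail s.bound) hpt)).exists
  obtain ⟨B, hB⟩ := exists_location_bound t
  let W : Set (LocWord M × List Y) :=
    (fun z : (LocWord M × List Y) × M => (z.1.1 * translate z.2 t, z.1.2 ++ [z.2 • y])) ''
      (s.words ×ˢ Set.univ)
  refine ⟨t, ⟨s.words ∪ W, max s.bound B, s.finite.union ((s.finite.prod Set.finite_univ).image _),
    ?_, ?_, ?_⟩, htp, Set.subset_union_left, fun x hx a => Or.inr ⟨(x, a), ⟨hx, trivial⟩, rfl⟩⟩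
  · rintro _ (hx | ⟨⟨x, a⟩, ⟨hx, -⟩, rfl⟩)
    · exact s.increasing _ hx
    · have := translate_mem_tailWords (a := a) htl
      exact increasing_mul.mpr ⟨s.increasing x hx, this.1, fun p hp q hq =>
        (s.lt_bound x hx p hp).trans_le (this.2 q hq)⟩
  · rintro _ (hx | ⟨⟨x, a⟩, ⟨hx, -⟩, rfl⟩) p hp
    · exact (s.lt_bound _ hx p hp).trans_le (le_max_left _ _)
    · rw [FreeMonoid.toList_mul, List.mem_append, toList_translate, List.mem_map] at hp
      obtain hp | ⟨q, hq, rfl⟩ := hp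
      · exact (s.lt_bound _ hx p hp).trans_le (le_max_left _ _)
      · exact (hB q hq).trans_le (le_max_right _ _)
  · rintro _ (hx | ⟨⟨x, a⟩, ⟨hx, -⟩, rfl⟩) h hh
    · exact s.color _ hx h hh
    · exact ht x hx a h ((length_le_length_foldr_absorbCons _ h).trans hh) hh

theorem exists_located_sequence [Finite κ]
    (hg : ∀ D C, D ≤ C → g D * g C = g C ∧ g C * g D = g C)
    {y : Y} (hy : ∀ a : M, g (a • y) = (g y).map (translate a))
    (htail : ∀ N, tailWords M N ∈ g y) (hpt : pointedWords M ∈ g y) (c : LocWord M → κ) (N : ℕ) :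
    ∃ (t : ℕ → LocWord M) (φ : List Y → κ), (∀ n, t n ∈ pointedWords M) ∧
      ∀ L : List (ℕ × M), (L.Pairwise fun p q => p.1 < q.1) →
        Increasing (L.map fun x => translate x.2 (t x.1)).prod ∧
        (((L.map fun x => x.2 • y).foldr absorbCons []).length ≤ N →
          c (L.map fun x => translate x.2 (t x.1)).prod =
            φ ((L.map fun x => x.2 • y).foldr absorbCons [])) := by
  -- The color of a list is the one its ultrafilter selects; this is the stage invariant for the
  -- empty word.
  choose φ hφ using fun l => exists_eventually_eq_of_finite (listUltra g l) c
  let s₀ : Stage g c φ N :=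
    { words := {(1, [])}
      bound := 0
      finite := Set.finite_singleton _
      increasing := by rintro _ rfl; exact List.Pairwise.nil
      lt_bound := by rintro _ rfl p hp; exact absurd hp List.not_mem_nil
      color := by
        rintro _ rfl h -
        simpa using hφ h }
  choose nextWord nextStage hnext using fun s : Stage g c φ N => s.exists_next hg hy htail hpt
  let s : ℕ → Stage g c φ N := fun n => Nat.rec s₀ (fun _ s => nextStage s) n
  let t : ℕ → LocWord M := fun n => nextWord (s n)
  have hmono : Monotone fun n => (s n).words :=
    monotone_nat_of_le_succ fun n => (hnext (s n)).2.1
  have hmem : ∀ L : List (ℕ × M), (L.Pairwise fun p q => p.1 < q.1) →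
      ∀ n, (∀ p ∈ L, p.1 < n) →
        ((L.map fun x => translate x.2 (t x.1)).prod, L.map fun x => x.2 • y) ∈ (s n).words := by
    intro L
    induction L using List.reverseRecOn with
    | nil => exact fun _ n _ => hmono (Nat.zero_le n) rfl
    | append_singleton L x ih =>
      intro hL n hn
      rw [List.pairwise_append] at hL
      have hx : x.1 + 1 ≤ n := hn x (by simp)
      have := ih hL.1 x.1 fun p hp => hL.2.2 p hp x (by simp)
      have := hmono hx ((hnext (s x.1)).2.2 _ this x.2)
      simpa using this
  refine ⟨t, φ, fun n => (hnext (s n)).1, fun L hL => ?_⟩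
  obtain ⟨n, hn⟩ := exists_location_bound (FreeMonoid.ofList L)
  have := hmem L hL n hn
  exact ⟨(s n).increasing _ this, fun hlen => by
    -- For the empty tail `listUltra` is principal at `1`, so the generic statement gives the actual
    -- color.
    have h : ∀ᶠ r in pure (1 : LocWord M), _ := (s n).color _ this [] hlen
    simpa using h⟩

end Construction

/-! ### From located words to words -/

section Words

variable {M Ω : Type*} [Monoid M] [MulAction M Ω] (X : ℕ → PointedMSet M Ω)

/-- The letter that `(n, b)` stands for. -/
def letter (p : ℕ × M) : Ω := p.2 • (X p.1).pt

theorem letter_mem (p : ℕ × M) : letter X p ∈ (X p.1).carrier := by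
  rw [← (X p.1).orbit_pt]
  exact ⟨p.2, rfl⟩

theorem locatedAt_map_letter (l : List (ℕ × M)) :
    LocatedAt X (l.map (letter X)) (l.map Prod.fst) := by
  unfold LocatedAt
  rw [List.forall₂_map_left_iff, List.forall₂_map_right_iff, List.forall₂_same]
  exact fun p _ => letter_mem X p

open Classical in
/-- The word that an increasing located word stands for; other located words are sent to the
empty word. -/
noncomputable def toWord (t : LocWord M) : Word X :=
  if h : Increasing t then
    ⟨t.toList.map (letter X), t.toList.map Prod.fst, List.pairwise_map.mpr h,
      locatedAt_map_letter X t.toList⟩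
  else ⟨[], [], List.Pairwise.nil, List.Forall₂.nil⟩

theorem toWord_val {t : LocWord M} (h : Increasing t) :
    (toWord X t).1 = t.toList.map (letter X) := by
  have : toWord X t = ⟨t.toList.map (letter X), t.toList.map Prod.fst, List.pairwise_map.mpr h,
      locatedAt_map_letter X t.toList⟩ := dif_pos h
  rw [this]

theorem smul_toWord (a : M) {t : LocWord M} (h : Increasing t) :
    a • toWord X t = toWord X (translate a t) := by
  apply Subtype.ext
  rw [toWord_val X (increasing_translate.mpr h), toList_translate]
  change (toWord X t).1.map (fun y => a • y) = _
  rw [toWord_val X h, List.map_map, List.map_map]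
  exact List.map_congr_left fun p _ => smul_smul a p.2 _

/-- The locations themselves witness that the partial products are defined. -/
theorem toWord_prod_mem : ∀ {k : ℕ} (t : Fin (k + 1) → LocWord M),
    Increasing (List.ofFn t).prod →
      toWord X (List.ofFn t).prod ∈ Word.prod fun j => toWord X (t j)
  | 0, t, _ => by
    simp [Word.prod]
  | k + 1, t, h => by
    rw [List.ofFn_succ, List.prod_cons] at h ⊢
    obtain ⟨h1, h2, -⟩ := increasing_mul.mp h
    refine Part.mem_bind (toWord_prod_mem (fun j => t j.succ) h2) ⟨?_, ?_⟩
    · refine ⟨(t 0).toList.map Prod.fst, (List.ofFn fun j : Fin (k + 1) =>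
        t j.succ).prod.toList.map Prod.fst, ?_, ?_, ?_⟩
      · rw [← List.map_append, ← FreeMonoid.toList_mul, List.pairwise_map]
        exact h
      · rw [toWord_val X h1]
        exact locatedAt_map_letter X _
      · rw [toWord_val X h2]
        exact locatedAt_map_letter X _
    · apply Subtype.ext
      change (toWord X (t 0)).1 ++ (toWord X _).1 = _
      rw [toWord_val X h, toWord_val X h1, toWord_val X h2, ← List.map_append]
      rfl

end Words

end MonoidRamsey

/-! ### The main theorem -/

open MonoidRamsey in
theorem corollary4p4 {M : Type*} [Monoid M] [Finite M] (hM : MonoidRamsey.AlmostRTrivial M)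
    (F : Set (MonoidRamsey.Vee (MonoidRamsey.YY M))) (hF : F.Finite)
    (y : MonoidRamsey.YY M) (hy : IsMax y)
    {Ω : Type*} [MulAction M Ω] (X : ℕ → MonoidRamsey.PointedMSet M Ω)
    {κ : Type*} [Finite κ] (c : MonoidRamsey.Word X → κ) :
    ∃ w : ℕ → MonoidRamsey.Word X,
      MonoidRamsey.IsBasic w ∧
      (∀ i, ∃ n, (X n).pt ∈ (w i).1) ∧
      ∃ φ : MonoidRamsey.Vee (MonoidRamsey.YY M) → κ,
        ∀ (k : ℕ) (i : Fin (k + 1) → ℕ) (a : Fin (k + 1) → M), StrictMono i →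
          MonoidRamsey.Vee.join (fun j => a j • y) ∈ F →
          ∃ p ∈ MonoidRamsey.Word.prod (fun j => a j • w (i j)),
            c p = φ (MonoidRamsey.Vee.join fun j => a j • y) := by
  obtain ⟨nf, hnf1, hnf2⟩ := exists_normalForm (P := YY M) Fr.comparable_of_le_of_le
  -- The bound up to which the recursion must control normal forms.
  obtain ⟨N, hN⟩ := (hF.image fun f => (nf f).length).bddAbove
  obtain ⟨g, hg, htop, hord⟩ := exists_equivariant_ultrafilters hM
  have : Finite (YY M) := inferInstanceAs (Finite {x : Set (XX M) // _})
  obtain ⟨t, φ, hpt, ht⟩ := exists_located_sequence (g := fun C => (g C).1)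
    (fun D C h => ⟨congrArg Subtype.val (hord D C h).1, congrArg Subtype.val (hord D C h).2⟩)
    (fun a : M => congrArg Subtype.val (hg a y)) (g y).2 (htop y (XX.top_mem_of_isMax hy))
    (fun t => c (toWord X t)) N
  have hpair : ∀ {k : ℕ} (i : Fin (k + 1) → ℕ) (a : Fin (k + 1) → M), StrictMono i →
      (List.ofFn fun j => (i j, a j)).Pairwise fun p q => p.1 < q.1 := fun i a hi =>
    List.pairwise_ofFn.mpr fun _ _ h => hi h
  have hinc : ∀ n, Increasing (t n) := fun n => by
    have := (ht [(n, 1)] (List.pairwise_singleton _ _)).1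
    simpa [translate_one] using this
  have hprod : ∀ {k : ℕ} (i : Fin (k + 1) → ℕ) (a : Fin (k + 1) → M), StrictMono i →
      toWord X (List.ofFn fun j => translate (a j) (t (i j))).prod ∈
        Word.prod fun j => a j • toWord X (t (i j)) := by
    intro k i a hi
    have := (ht _ (hpair i a hi)).1
    rw [List.map_ofFn] at this
    simp only [smul_toWord X _ (hinc _)]
    exact toWord_prod_mem X _ this
  -- Only well-definedness of `nf` on `Vee (YY M)` is needed for the color to depend on the join
  -- alone. Basicness is the case where every `a j` is `1`.
  refine ⟨fun n => toWord X (t n), fun k i hi => ?_, fun n => ?_, fun f => φ (nf f),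
    fun k i a hi hmem => ⟨_, hprod i a hi, ?_⟩⟩
  · obtain ⟨h, -⟩ := hprod i (fun _ => 1) hi
    simpa only [smul_toWord X _ (hinc _), translate_one] using h
  · obtain ⟨m, hm⟩ := hpt n
    refine ⟨m, ?_⟩
    rw [toWord_val X (hinc n)]
    exact List.mem_map.mpr ⟨(m, 1), hm, one_smul M _⟩
  · have := (ht _ (hpair i a hi)).2
    rw [List.map_ofFn, List.map_ofFn] at this
    have e := foldr_absorbCons_eq_normalForm_join hnf1 hnf2 (fun j => a j • y)
    refine (this ?_).trans (congrArg φ e)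
    change ((List.ofFn fun j => a j • y).foldr absorbCons []).length ≤ N
    rw [e]
    exact hN ⟨_, hmem, rfl⟩
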